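/- Let $n \ge 3$, and let $\Sigma$ be the $(n,2)$-biregular tree, that is, the tree whose vertices are properly coloured by two colours, those of the first colour having degree $n$ and those of the second having degree $2$. Let $G = \mathrm{Aut}(\Sigma)$ with the compact-open topology (equivalently, the topology of pointwise convergence on the vertex set $V$ of $\Sigma$). A discrete subgroup $\Gamma \le G$ is a lattice if $\Gamma\backslash G$ carries a nonzero finite $G$-invariant measure, and it is uniform if $\Gamma \backslash G$ is compact. There is a Haar measure $\mu$ on $G$ such that for every discrete subgroup $\Gamma \le G$ all stabilisers $\Gamma_v$, $v\in V$, are finite and the covolume, i.e. the $\mu$-measure of a fundamental domain of $\Gamma$ acting on $G$ by left multiplication (which exists), is $$\mu(\Gamma \backslash G) = \sum_{\Gamma v \in \Gamma \backslash V} \frac{1}{|\Gamma_v|} \in (0,\infty],$$ and, with this normalisation of $\mu$, the following holds: for every prime $p < n$ and every $\alpha \in \mathbb N$ there is a uniform lattice $\Gamma$ in $G$ whose covolume is $\mu(\Gamma \backslash G) = a/b$ with coprime positive integers $a, b$ such that $p^\alpha$ divides $b$. -/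

import Mathlib

open MeasureTheory
open scoped ENNReal

namespace TreeLattice

/-- `T` is an `(m, k)`-biregular tree: a tree whose vertices are properly coloured by two colours,
all vertices of the first colour having degree `m` and all those of the second degree `k`. -/
def IsBiregularTree {V : Type*} (T : SimpleGraph V) (m k : ℕ) : Prop :=
  T.IsTree ∧ ∃ c : T.Coloring Bool,
    ∀ v : V, (T.neighborSet v).encard = if c v = true then (m : ℕ∞) else (k : ℕ∞)

/-- The topology of pointwise convergence on the (discrete) vertex set on the group of
automorphisms of a graph. For a connected locally finite graph this is the compact-open topology
on the group of automorphisms of its geometric realisation. -/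
instance autTopology {V : Type*} (T : SimpleGraph V) : TopologicalSpace (T ≃g T) :=
  TopologicalSpace.induced (fun (g : T ≃g T) (v : V) => g v)
    (@Pi.topologicalSpace V (fun _ => V) (fun _ => ⊥))

/-- Automorphism groups of graphs carry the Borel σ-algebra. -/
instance autMeasurableSpace {V : Type*} (T : SimpleGraph V) : MeasurableSpace (T ≃g T) :=
  borel _

instance autBorelSpace {V : Type*} (T : SimpleGraph V) : BorelSpace (T ≃g T) := ⟨rfl⟩

section Lattices

/-- The quotient `Γ \ G` of a group by the left multiplication action of a subgroup. It carries
the quotient topology and the quotient σ-algebra. -/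
abbrev LeftQuotient {G : Type*} [Group G] (Γ : Subgroup G) : Type _ :=
  MulAction.orbitRel.Quotient Γ G

/-- The right translation `Γ x ↦ Γ x g` of `Γ \ G`. -/
def rightTranslate {G : Type*} [Group G] (Γ : Subgroup G) (g : G) :
    LeftQuotient Γ → LeftQuotient Γ :=
  Quotient.map' (fun x => x * g) (by
    rintro x y ⟨γ, rfl⟩
    exact ⟨γ, by simp [Subgroup.smul_def, mul_assoc]⟩)

/-- A lattice in `G`: a discrete subgroup `Γ` such that `Γ \ G` carries a nonzero finite measure
that is invariant under the right action of `G`. -/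
structure IsLattice {G : Type*} [Group G] [TopologicalSpace G] [MeasurableSpace G]
    (Γ : Subgroup G) : Prop where
  discrete : DiscreteTopology Γ
  exists_measure : ∃ ν : Measure (LeftQuotient Γ), ν ≠ 0 ∧ IsFiniteMeasure ν ∧
    ∀ g : G, ν.map (rightTranslate Γ g) = ν

/-- A lattice `Γ` in `G` is uniform if `Γ \ G` is compact. -/
structure IsUniformLattice {G : Type*} [Group G] [TopologicalSpace G] [MeasurableSpace G]
    (Γ : Subgroup G) : Prop extends IsLattice Γ where
  compact : CompactSpace (LeftQuotient Γ)

/-- `μ` is the Haar measure on `G` with the normalisation given by the `G`-set `V`: for each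
discrete subgroup `Γ` of `G`, the covolume `μ (Γ \ G)` (the `μ`-measure of a fundamental domain of
`Γ` acting on `G` by left multiplication) is the sum over the `Γ`-orbits of points `v` of `V` of
the numbers `1 / |Γ_v|`. -/
structure IsNormalizedHaar {G : Type*} [Group G] [TopologicalSpace G] [MeasurableSpace G]
    (V : Type*) [MulAction G V] (μ : Measure G) : Prop where
  haar : μ.IsHaarMeasure
  exists_fundamentalDomain : ∀ Γ : Subgroup G, DiscreteTopology Γ → HasFundamentalDomain Γ G μ
  finite_stabilizer : ∀ Γ : Subgroup G, DiscreteTopology Γ →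
    ∀ v : V, Finite (MulAction.stabilizer Γ v)
  covolume_eq : ∀ Γ : Subgroup G, DiscreteTopology Γ →
    covolume Γ G μ = ∑' x : MulAction.orbitRel.Quotient Γ V,
      ((Nat.card (MulAction.stabilizer Γ x.out) : ℝ≥0∞))⁻¹

end Lattices

end TreeLattice

/-!
Let `T` be the `(n, 2)`-biregular tree and `G` its automorphism group.

**Mass formula.** Vertex stabilisers `G_v` are compact and open. If `D` is a fundamental domain of
a discrete subgroup `Γ`, unfolding the transporter `{g | g v = w}`, a coset of `G_v`, along the
translates of `D` shows that the part of `D` that moves `v` into `Γ w` has measure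
`μ(G_v) / |Γ_w|` (`card_mul_measure_orbit`). Hence `μ(D) / μ(G_v)` is the sum of `1 / |Γ_w|` over
the `Γ`-orbits contained in `G v`. Since `G` has finitely many orbits on the vertices, the
normalisation in which the numbers `1 / μ(G_v)`, with `v` ranging over representatives of the
`G`-orbits, add up to `1` gives the formula for the covolume (`exists_isNormalizedHaar`).

**Lattices.** A subgroup with finitely many vertex orbits and finite stabilisers is a uniform
lattice (`isUniformLattice_of_finite`): it has a fundamental domain `D` of finite measure, right
translates of `D` are fundamental domains too, so `G` is unimodular and Haar measure on `D` descends
to an invariant measure on the quotient.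

**Examples with large denominators.** If `π : T → X` is a covering of a finite connected graph, the
automorphisms of `T` that lift automorphisms of `X` form a uniform lattice `Γ` whose mass is
`|X| / |Aut X|` (`tsum_inv_card_stabilizer_liftGroup`). Take for `X` the subdivision of a closed
chain of `2 m` vertices in which consecutive vertices are joined alternately by `p` and by `n - p`
parallel edges. It is `(n, 2)`-biregular and has only `m (n + 2)` vertices, whereas the `m`-th power
of the symmetric group of degree `p` acts on it faithfully, so that `p ^ m` divides `|Aut X|`. As
`m (n + 2)` grows only linearly in `m`, the power of `p` in the denominator is unbounded.

Coverings by trees, their lifts and their uniqueness all come from one construction from the root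
outwards (`exists_covering_of_local`).
-/

namespace TreeLattice

/-! ### Coverings of graphs by trees -/

section Coverings

variable {V W X : Type*}

/-- A map between the vertex sets of two graphs is a covering if it maps the neighbours of each
vertex `v` bijectively onto the neighbours of the image of `v`. Surjectivity is not demanded; it
follows if the target is connected and the source is nonempty. -/
def IsCovering (G : SimpleGraph V) (H : SimpleGraph W) (f : V → W) : Prop :=
  ∀ v, Set.BijOn f (G.neighborSet v) (H.neighborSet (f v))

namespace IsCovering

variable {G : SimpleGraph V} {H : SimpleGraph W} {K : SimpleGraph X} {f : V → W}

lemma adj (hf : IsCovering G H f) {u v : V} (h : G.Adj u v) : H.Adj (f u) (f v) :=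
  (hf u).mapsTo h

lemma comp {g : W → X} (hg : IsCovering H K g) (hf : IsCovering G H f) :
    IsCovering G K (g ∘ f) :=
  fun v => (hg (f v)).comp (hf v)

lemma of_iso (g : G ≃g H) : IsCovering G H g := fun v =>
  ⟨fun _ h => g.map_adj_iff.2 h, g.injective.injOn, fun w h =>
    ⟨g.symm w, by
      have : G.Adj (g.symm (g v)) (g.symm w) := g.symm.map_adj_iff.2 h
      simpa using this, by simp⟩⟩

lemma surjective [Nonempty V] (hf : IsCovering G H f) (hH : H.Connected) :
    Function.Surjective f := by
  obtain ⟨v₀⟩ := ‹Nonempty V›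
  intro x
  obtain ⟨p⟩ := hH (f v₀) x
  have key : ∀ {a b : W}, H.Walk a b → a ∈ Set.range f → b ∈ Set.range f := by
    intro a b q
    induction q with
    | nil => exact id
    | cons h _ ih =>
      rintro ⟨v, rfl⟩
      obtain ⟨w, -, rfl⟩ := (hf v).surjOn h
      exact ih ⟨w, rfl⟩
  exact key p ⟨v₀, rfl⟩

/-- Uniqueness of lifts: two lifts of the same map along a covering that agree at one vertex of a
connected graph agree everywhere. -/
lemma lift_unique {g : W → X} (hg : IsCovering H K g) {f f' : V → W}
    (hG : G.Connected) (hf : ∀ u v, G.Adj u v → H.Adj (f u) (f v))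
    (hf' : ∀ u v, G.Adj u v → H.Adj (f' u) (f' v)) (h : ∀ v, g (f v) = g (f' v))
    {v₀ : V} (h₀ : f v₀ = f' v₀) : f = f' := by
  funext x
  obtain ⟨p⟩ := hG v₀ x
  have key : ∀ {a b : V}, G.Walk a b → f a = f' a → f b = f' b := by
    intro a b q
    induction q with
    | nil => exact id
    | @cons a c b e _ ih =>
      intro ha
      exact ih ((hg (f a)).injOn (hf _ _ e) (ha ▸ hf' _ _ e) (h c))
  exact key p h₀

end IsCovering

/-- In a tree with a chosen root `r`, every vertex has a parent. By convention the parent of the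
root is the root itself. -/
lemma exists_parent {T : SimpleGraph V} (hT : T.IsTree) (r : V) :
    ∃ par : V → V, (∀ v, v ≠ r → T.Adj (par v) v ∧ T.dist r v = T.dist r (par v) + 1) ∧
      ∀ u v, T.Adj u v → (v ≠ r ∧ par v = u) ∨ (u ≠ r ∧ par u = v) := by
  have hc := hT.connected
  choose q hq hlen using fun v => hc.exists_path_of_dist r v
  -- a neighbour of `v` that is closer to the root is the last vertex but one of the path to `v`
  have key : ∀ u v, T.Adj u v → T.dist r v = T.dist r u + 1 → v ≠ r ∧ (q v).penultimate = u := by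
    intro u v h hd
    refine ⟨by rintro rfl; simp at hd, ?_⟩
    have hp : ((q u).concat h).IsPath :=
      SimpleGraph.Walk.isPath_of_length_eq_dist _ (by
        rw [SimpleGraph.Walk.length_concat, hlen, hd])
    rw [(hT.existsUnique_path r v).unique (hq v) hp]
    simp
  refine ⟨fun v => (q v).penultimate, fun v hv => ?_, fun u v h => ?_⟩
  · have hnil : ¬ (q v).Nil := fun h => hv h.eq.symm
    have ha : T.Adj (q v).penultimate v := (q v).adj_penultimate hnil
    refine ⟨ha, ?_⟩
    have h1 : T.dist r (q v).penultimate ≤ T.dist r v - 1 := by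
      refine (SimpleGraph.dist_le (q v).dropLast).trans ?_
      rw [← hlen v]
      simp
    rcases hT.dist_eq_dist_add_one_of_adj r ha with h | h
    · omega
    · exact h
  · rcases hT.dist_eq_dist_add_one_of_adj r h with h' | h'
    · exact Or.inr (key v u h.symm h')
    · exact Or.inl (key u v h h')

/-- Coverings of graphs by trees can be built from the root outwards: let `P v y` be a condition
for a covering to map `v` to `y`. If, whenever `P v y` holds, the neighbours of `v` can be mapped
bijectively to those of `y` in accordance with `P` and with a prescribed value at one neighbour,
then there is a covering in accordance with `P`, with a prescribed value at the root. -/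
lemma exists_covering_of_local {T : SimpleGraph V} (hT : T.IsTree) {H : SimpleGraph W}
    (P : V → W → Prop)
    (hP : ∀ v y u z, P v y → ∃ f : V → W, Set.BijOn f (T.neighborSet v) (H.neighborSet y) ∧
      (∀ w ∈ T.neighborSet v, P w (f w)) ∧
      (u ∈ T.neighborSet v → z ∈ H.neighborSet y → P u z → f u = z))
    (r : V) (y : W) (hr : P r y) :
    ∃ f : V → W, IsCovering T H f ∧ f r = y ∧ ∀ v, P v (f v) := by
  classical
  obtain ⟨par, hpar, hadj⟩ := exists_parent hT r
  have : Nonempty W := ⟨y⟩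
  choose! B hB hBP hBu using hP
  let par' : V → V := fun v => if v = r then r else par v
  -- `F k` is the value of the covering on the ball of radius `k` about the root
  let F : ℕ → V → W := fun k => Nat.rec (fun _ => y)
    (fun _ F v => if v = r then y else
      B (par' v) (F (par' v)) (par' (par' v)) (F (par' (par' v))) v) k
  have hdist : ∀ v, v ≠ r → T.dist r v = T.dist r (par' v) + 1 := fun v hv => by
    simpa [par', hv] using (hpar v hv).2
  have hroot : ∀ k, F k r = y := fun k => by cases k <;> simp [F]
  have hstep : ∀ k v, v ≠ r →
      F (k + 1) v = B (par' v) (F k (par' v)) (par' (par' v)) (F k (par' (par' v))) v :=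
    fun k v hv => by simp [F, hv]
  have hle : ∀ v, T.dist r (par' v) ≤ T.dist r v - 1 := fun v => by
    by_cases hv : v = r
    · simp [par', hv]
    · rw [hdist v hv]; simp
  have hstab : ∀ k l v, T.dist r v ≤ k → T.dist r v ≤ l → F k v = F l v := by
    intro k
    induction k with
    | zero =>
      intro l v hk hl
      have : v = r := by
        by_contra hv
        have := hdist v hv
        omega
      rw [this, hroot, hroot]
    | succ k ih =>
      intro l v hk hl
      by_cases hv : v = r
      · rw [hv]
        exact (hroot (k + 1)).trans (hroot l).symm
      · have h0 := hdist v hv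
        obtain ⟨l, rfl⟩ : ∃ l', l = l' + 1 := ⟨l - 1, by omega⟩
        have h1 := hle v
        have h2 := hle (par' v)
        rw [hstep k v hv, hstep l v hv, ih l (par' v) (by omega) (by omega),
          ih l (par' (par' v)) (by omega) (by omega)]
  let f : V → W := fun v => F (T.dist r v) v
  have hfr : f r = y := hroot _
  have hf : ∀ v, v ≠ r → f v = B (par' v) (f (par' v)) (par' (par' v)) (f (par' (par' v))) v := by
    intro v hv
    have h0 := hdist v hv
    have h2 := hle (par' v)
    have : f v = F (T.dist r (par' v) + 1) v :=
      hstab (T.dist r v) (T.dist r (par' v) + 1) v le_rfl (by omega)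
    have h3 : F (T.dist r (par' v)) (par' (par' v)) = f (par' (par' v)) :=
      hstab (T.dist r (par' v)) _ _ (by omega) le_rfl
    rw [this, hstep _ _ hv, h3]
  have hPf : ∀ d v, T.dist r v = d → P v (f v) ∧ (v ≠ r → f v ∈ H.neighborSet (f (par' v))) := by
    intro d
    induction d with
    | zero =>
      intro v hv
      have : v = r := by
        by_contra hv'
        have := hdist v hv'
        omega
      subst this
      exact ⟨hfr ▸ hr, fun h => absurd rfl h⟩
    | succ d ih =>
      intro v hv
      have hvr : v ≠ r := by rintro rfl; simp at hv
      have hd := hdist v hvr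
      have hPw := (ih (par' v) (by omega)).1
      have hmem : v ∈ T.neighborSet (par' v) := by
        simpa [par', hvr] using (hpar v hvr).1
      rw [hf v hvr]
      exact ⟨hBP _ _ (par' (par' v)) (f (par' (par' v))) hPw v hmem, fun _ =>
        (hB _ _ (par' (par' v)) (f (par' (par' v))) hPw).mapsTo hmem⟩
  refine ⟨f, fun v => ?_, hfr, fun v => (hPf _ v rfl).1⟩
  have hPv := (hPf _ v rfl).1
  refine (hB v (f v) (par' v) (f (par' v)) hPv).congr fun w hw => ?_
  rcases hadj v w hw with ⟨hwr, hwv⟩ | ⟨hvr, hvw⟩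
  · have hwv' : par' w = v := by simpa [par', hwr] using hwv
    rw [hf w hwr, hwv']
  · have hvw' : par' v = w := by simpa [par', hvr] using hvw
    have h1 := hBu v (f v) w (f w) hPv hw
      (by have := (hPf _ v rfl).2 hvr; rw [hvw'] at this; exact this.symm) (hPf _ w rfl).1
    rw [hvw']
    exact h1

/-- A biregular tree covers each graph that is coloured with the same degrees. -/
lemma exists_covering {T : SimpleGraph V} (hT : T.IsTree) {H : SimpleGraph W}
    (c : T.Coloring Bool) (c' : H.Coloring Bool) (d : Bool → ℕ)
    (hd : ∀ v, (T.neighborSet v).encard = d (c v)) (hd' : ∀ w, (H.neighborSet w).encard = d (c' w))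
    (r : V) (y : W) (h : c r = c' y) :
    ∃ f : V → W, IsCovering T H f ∧ f r = y ∧ ∀ v, c v = c' (f v) := by
  classical
  refine exists_covering_of_local hT (fun v w => c v = c' w) (fun v y u z hvy => ?_) r y h
  have hfin : (T.neighborSet v).Finite := Set.finite_of_encard_eq_coe (hd v)
  have : Nonempty W := ⟨y⟩
  obtain ⟨f, hf⟩ := hfin.exists_bijOn_of_encard_eq
    (t := H.neighborSet y) (by rw [hd, hd', hvy])
  have hcol : ∀ g : V → W, Set.MapsTo g (T.neighborSet v) (H.neighborSet y) →
      ∀ w ∈ T.neighborSet v, c w = c' (g w) := fun g hg w hw => by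
    have h1 : c v ≠ c w := c.valid hw
    have h2 : c' y ≠ c' (g w) := c'.valid (hg hw)
    rw [hvy] at h1
    cases h3 : c' y <;> cases h4 : c w <;> cases h5 : c' (g w) <;> simp_all
  by_cases huz : u ∈ T.neighborSet v ∧ z ∈ H.neighborSet y
  · -- correct the value at `u` by a transposition of the neighbours of `y`
    have hs : Set.BijOn (Equiv.swap (f u) z) (H.neighborSet y) (H.neighborSet y) := by
      have hm : Set.MapsTo (Equiv.swap (f u) z) (H.neighborSet y) (H.neighborSet y) := by
        intro x hx
        by_cases h1 : x = f u
        · rw [h1, Equiv.swap_apply_left]; exact huz.2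
        by_cases h2 : x = z
        · rw [h2, Equiv.swap_apply_right]; exact hf.mapsTo huz.1
        · rwa [Equiv.swap_apply_of_ne_of_ne h1 h2]
      exact ⟨hm, (Equiv.injective _).injOn, fun x hx => ⟨_, hm hx, Equiv.swap_apply_self _ _ _⟩⟩
    exact ⟨_, hs.comp hf, hcol _ (hs.comp hf).mapsTo, fun _ _ _ => by simp⟩
  · exact ⟨f, hf, hcol f hf.mapsTo, fun h1 h2 => absurd ⟨h1, h2⟩ huz⟩

/-- Coverings of a graph by a tree lift along coverings. -/
lemma exists_lift {T : SimpleGraph V} (hT : T.IsTree) {G : SimpleGraph X} {H : SimpleGraph W}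
    {f : V → W} {g : X → W} (hf : IsCovering T H f) (hg : IsCovering G H g)
    {v : V} {w : X} (h : f v = g w) :
    ∃ k : V → X, IsCovering T G k ∧ k v = w ∧ ∀ u, f u = g (k u) := by
  refine exists_covering_of_local hT (fun v w => f v = g w) (fun v y u z hvy => ?_) v w h
  have : Nonempty X := ⟨y⟩
  have hg' : Set.BijOn g (G.neighborSet y) (H.neighborSet (f v)) := hvy ▸ hg y
  have hinv := hg'.invOn_invFunOn
  have hsymm := hg'.symm hinv.symm
  refine ⟨_, hsymm.comp (hf v), fun w hw => ?_, fun hu hz huz => ?_⟩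
  · exact (hinv.2 ((hf v).mapsTo hw)).symm
  · simp only [Function.comp, huz]
    exact hinv.1 hz

/-- Two coverings `f`, `g` of a graph by trees that agree at `v` and `w` differ by an isomorphism
of the trees that maps `v` to `w`. -/
lemma exists_iso_of_covering {T : SimpleGraph V} (hT : T.IsTree) {S : SimpleGraph X}
    (hS : S.IsTree) {H : SimpleGraph W} {f : V → W} {g : X → W} (hf : IsCovering T H f)
    (hg : IsCovering S H g) {v : V} {w : X} (h : f v = g w) :
    ∃ k : T ≃g S, k v = w ∧ ∀ u, g (k u) = f u := by
  obtain ⟨k, hk, hkv, hkf⟩ := exists_lift hT hf hg h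
  obtain ⟨l, hl, hlw, hlg⟩ := exists_lift hS hg hf h.symm
  have h1 : l ∘ k = id := hf.lift_unique (f := l ∘ k) (f' := id) hT.connected
    (fun _ _ e => (hl.comp hk).adj e) (fun _ _ e => e)
    (fun u => by simp [← hlg, ← hkf]) (v₀ := v) (by simp [hkv, hlw])
  have h2 : k ∘ l = id := hg.lift_unique (f := k ∘ l) (f' := id) hS.connected
    (fun _ _ e => (hk.comp hl).adj e) (fun _ _ e => e)
    (fun u => by simp [← hlg, ← hkf]) (v₀ := w) (by simp [hkv, hlw])
  refine ⟨⟨⟨k, l, congrFun h1, congrFun h2⟩, fun {a b} => ⟨fun e => ?_, fun e => hk.adj e⟩⟩,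
    hkv, fun u => (hkf u).symm⟩
  have := hl.adj e
  rwa [Equiv.coe_fn_mk, show l (k a) = a from congrFun h1 a,
    show l (k b) = b from congrFun h1 b] at this

/-- The automorphism group of a biregular tree is transitive on the vertices of each colour. -/
lemma exists_aut_of_color_eq {T : SimpleGraph V} (hT : T.IsTree) (c : T.Coloring Bool)
    (d : Bool → ℕ) (hd : ∀ v, (T.neighborSet v).encard = d (c v)) {v w : V} (h : c v = c w) :
    ∃ g : T ≃g T, g v = w := by
  obtain ⟨f, hf, hfv, -⟩ := exists_covering hT c c d hd hd v w h
  obtain ⟨k, hk, -⟩ := exists_iso_of_covering hT hT hf (IsCovering.of_iso (SimpleGraph.Iso.refl))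
    (v := v) (w := w) hfv
  exact ⟨k, hk⟩

end Coverings

/-! ### The topology of the automorphism group -/

section Topology

open Filter Topology

variable {V : Type*} {T : SimpleGraph V}

lemma tendsto_aut_nhds_iff {Y : Type*} {l : Filter Y} {f : Y → T ≃g T} {g : T ≃g T} :
    Tendsto f l (𝓝 g) ↔ ∀ v, ∀ᶠ y in l, f y v = g v := by
  let _ : TopologicalSpace V := ⊥
  have : DiscreteTopology V := ⟨rfl⟩
  rw [nhds_induced, tendsto_comap_iff, tendsto_pi_nhds]
  simp only [nhds_discrete, tendsto_pure, Function.comp]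

lemma continuous_aut_iff {Y : Type*} [TopologicalSpace Y] {f : Y → T ≃g T} :
    Continuous f ↔ ∀ y v, ∀ᶠ z in 𝓝 y, f z v = f y v := by
  simp only [continuous_iff_continuousAt, ContinuousAt, tendsto_aut_nhds_iff]

lemma eventually_aut_apply_eq (g : T ≃g T) (v : V) : ∀ᶠ h in 𝓝 g, h v = g v :=
  tendsto_aut_nhds_iff.1 tendsto_id v

instance : IsTopologicalGroup (T ≃g T) where
  continuous_mul := continuous_aut_iff.2 fun ⟨a, b⟩ v => by
    filter_upwards [continuous_snd.continuousAt.eventually (eventually_aut_apply_eq b v),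
      continuous_fst.continuousAt.eventually (eventually_aut_apply_eq a (b v))] with z h1 h2
    change z.1 (z.2 v) = a (b v)
    rw [h1, h2]
  continuous_inv := continuous_aut_iff.2 fun a v => by
    filter_upwards [eventually_aut_apply_eq a (a⁻¹ v)] with z h
    have : z (a⁻¹ v) = v := h.trans (RelIso.apply_inv_self a v)
    conv_lhs => rw [← this]
    exact RelIso.inv_apply_self z _

instance : T2Space (T ≃g T) := by
  let _ : TopologicalSpace V := ⊥
  have : DiscreteTopology V := ⟨rfl⟩
  exact T2Space.of_injective_continuous (f := fun (g : T ≃g T) (v : V) => g v)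
    DFunLike.coe_injective continuous_induced_dom

instance [Countable V] : SecondCountableTopology (T ≃g T) := by
  let _ : TopologicalSpace V := ⊥
  have : DiscreteTopology V := ⟨rfl⟩
  exact TopologicalSpace.secondCountableTopology_induced _ _ _

lemma isOpen_stabilizer_aut (v : V) :
    IsOpen (MulAction.stabilizer (T ≃g T) v : Set (T ≃g T)) := by
  rw [isOpen_iff_mem_nhds]
  intro g hg
  filter_upwards [eventually_aut_apply_eq g v] with h hh
  exact hh.trans hg

lemma countable_of_locallyFinite (hT : T.Connected) (hfin : ∀ v, (T.neighborSet v).Finite) :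
    Countable V := by
  obtain ⟨v⟩ := hT.nonempty
  let S : ℕ → Set V := fun k => Nat.rec {v} (fun _ s => ⋃ u ∈ s, T.neighborSet u) k
  have hS : ∀ k, (S k).Countable := fun k => by
    induction k with
    | zero => exact Set.countable_singleton v
    | succ k ih => exact ih.biUnion fun u _ => (hfin u).countable
  have hstep : ∀ {a b : V}, T.Walk a b → ∀ k, a ∈ S k → ∃ l, b ∈ S l := by
    intro a b p
    induction p with
    | nil => exact fun k hk => ⟨k, hk⟩
    | cons h _ ih => exact fun k hk => ih (k + 1) (Set.mem_biUnion hk h)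
  refine Set.countable_univ_iff.1 ((Set.countable_iUnion hS).mono fun w _ => ?_)
  obtain ⟨p⟩ := hT v w
  exact Set.mem_iUnion.2 (hstep p 0 rfl)

/-- The orbits of a vertex stabiliser in a connected locally finite graph are finite. -/
lemma finite_image_stabilizer (hT : T.Connected) (hfin : ∀ v, (T.neighborSet v).Finite) (v w : V) :
    {u | ∃ g : T ≃g T, g v = v ∧ g w = u}.Finite := by
  obtain ⟨p⟩ := hT v w
  have hstep : ∀ {a b : V}, T.Walk a b → {u | ∃ g : T ≃g T, g v = v ∧ g a = u}.Finite →
      {u | ∃ g : T ≃g T, g v = v ∧ g b = u}.Finite := by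
    intro a b p
    induction p with
    | nil => exact id
    | cons h _ ih =>
      refine fun ha => ih ((ha.biUnion fun u _ => hfin u).subset ?_)
      rintro _ ⟨g, hg, rfl⟩
      exact Set.mem_biUnion ⟨g, hg, rfl⟩ (g.map_adj_iff.2 h)
  exact hstep p ((Set.finite_singleton v).subset (by rintro _ ⟨g, hg, rfl⟩; exact hg))

/-- Vertex stabilisers are compact, since their orbits are finite. -/
lemma isCompact_stabilizer_aut (hT : T.Connected) (hfin : ∀ v, (T.neighborSet v).Finite) (v : V) :
    IsCompact (MulAction.stabilizer (T ≃g T) v : Set (T ≃g T)) := by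
  rw [isCompact_iff_ultrafilter_le_nhds]
  intro F hF
  rw [le_principal_iff] at hF
  have hconst : ∀ f : (T ≃g T) → V, (f '' MulAction.stabilizer (T ≃g T) v).Finite →
      ∃ u, ∀ᶠ g in F, f g = u := by
    intro f hf
    have hmem : (⋃ u ∈ f '' MulAction.stabilizer (T ≃g T) v, {g | f g = u}) ∈ F :=
      F.sets_of_superset hF fun g hg => Set.mem_biUnion (Set.mem_image_of_mem f hg) rfl
    obtain ⟨u, -, hu⟩ := (Ultrafilter.finite_biUnion_mem_iff hf).1 hmem
    exact ⟨u, hu⟩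
  -- along an ultrafilter, the values of automorphisms and of their inverses are constant
  choose φ hφ using fun w => hconst (fun g => g w)
    ((finite_image_stabilizer hT hfin v w).subset (by
      rintro _ ⟨g, hg, rfl⟩
      exact ⟨g, hg, rfl⟩))
  choose ψ hψ using fun w => hconst (fun g => g⁻¹ w)
    ((finite_image_stabilizer hT hfin v w).subset (by
      rintro _ ⟨g, hg, rfl⟩
      exact ⟨g⁻¹, inv_mem (s := MulAction.stabilizer (T ≃g T) v) hg, rfl⟩))
  let e : T ≃g T := ⟨⟨φ, ψ, fun w => by
      obtain ⟨g, h1, h2⟩ := ((hφ w).and (hψ (φ w))).exists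
      rw [← h2, ← h1]
      exact RelIso.inv_apply_self g w, fun w => by
      obtain ⟨g, h1, h2⟩ := ((hψ w).and (hφ (ψ w))).exists
      rw [← h2, ← h1]
      exact RelIso.apply_inv_self g w⟩, fun {a b} => by
      obtain ⟨g, h1, h2⟩ := ((hφ a).and (hφ b)).exists
      rw [Equiv.coe_fn_mk, ← h1, ← h2]
      exact g.map_adj_iff⟩
  refine ⟨e, ?_, tendsto_aut_nhds_iff.2 hφ⟩
  obtain ⟨g, h1, h2⟩ := ((hφ v).and hF).exists
  exact h1.symm.trans h2

end Topology

/-! ### Discrete subgroups and their covolumes -/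

section Covolume

open scoped Topology

variable {G V : Type*} [Group G] [MulAction G V]

lemma transporter_eq_image {v w : V} {g : G} (hg : g • v = w) :
    {x : G | x • v = w} = (fun x => g * x) '' (MulAction.stabilizer G v : Set G) := by
  ext x
  constructor
  · intro hx
    refine ⟨g⁻¹ * x, ?_, by simp⟩
    change (g⁻¹ * x) • v = v
    rw [mul_smul, (hx : x • v = w), ← hg, inv_smul_smul]
  · rintro ⟨y, hy, rfl⟩
    change (g * y) • v = w
    rw [mul_smul, (hy : y • v = v), hg]

/-- In a group action, the number of group elements that move `w` to `u`. -/
lemma tsum_smul_eq {Γ : Type*} [Group Γ] [MulAction Γ V] (w u : V)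
    [Finite (MulAction.stabilizer Γ w)] :
    ∑' γ : Γ, ({u} : Set V).indicator (1 : V → ℝ≥0∞) (γ • w) =
      (MulAction.orbit Γ w).indicator (fun _ => (Nat.card (MulAction.stabilizer Γ w) : ℝ≥0∞)) u := by
  classical
  by_cases h : u ∈ MulAction.orbit Γ w
  · obtain ⟨γ₀, rfl⟩ := h
    rw [Set.indicator_of_mem (MulAction.mem_orbit w γ₀), ← (Equiv.mulLeft γ₀).tsum_eq]
    have : ∀ γ : Γ, ({γ₀ • w} : Set V).indicator (1 : V → ℝ≥0∞) (Equiv.mulLeft γ₀ γ • w) =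
        (MulAction.stabilizer Γ w : Set Γ).indicator (fun _ => 1) γ := by
      intro γ
      simp only [Set.indicator_apply, Set.mem_singleton_iff, Equiv.coe_mulLeft, mul_smul,
        smul_left_cancel_iff, SetLike.mem_coe, MulAction.mem_stabilizer_iff, Pi.one_apply]
    simp_rw [this]
    have hsum := tsum_subtype (MulAction.stabilizer Γ w : Set Γ) (fun _ => (1 : ℝ≥0∞))
    rw [← hsum, ENNReal.tsum_set_one]
    have hf : (MulAction.stabilizer Γ w : Set Γ).Finite := Set.toFinite _
    rw [← hf.cast_ncard_eq]
    simp [Set.ncard]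
    rfl
  · rw [Set.indicator_of_notMem h]
    refine ENNReal.tsum_eq_zero.2 fun γ => Set.indicator_of_notMem ?_ _
    rintro rfl
    exact h ⟨γ, rfl⟩

variable [TopologicalSpace G]

lemma countable_of_discrete [SecondCountableTopology G] (Γ : Subgroup G) [DiscreteTopology Γ] :
    Countable Γ :=
  TopologicalSpace.separableSpace_iff_countable.1 inferInstance

variable [IsTopologicalGroup G]

lemma isOpen_transporter (hopen : ∀ v : V, IsOpen (MulAction.stabilizer G v : Set G)) (v w : V) :
    IsOpen {g : G | g • v = w} := by
  rw [isOpen_iff_mem_nhds]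
  intro g hg
  have h1 : (MulAction.stabilizer G v : Set G) ∈ 𝓝 (g⁻¹ * g) := by
    rw [inv_mul_cancel]
    exact (hopen v).mem_nhds (one_mem (MulAction.stabilizer G v))
  filter_upwards [(continuous_const_mul g⁻¹).continuousAt h1] with x hx
  have hx' : (g⁻¹ * x) • v = v := hx
  change x • v = w
  rw [← (hg : g • v = w)]
  rw [mul_smul, inv_smul_eq_iff] at hx'
  exact hx'

lemma isCompact_transporter (hcomp : ∀ v : V, IsCompact (MulAction.stabilizer G v : Set G))
    (v w : V) : IsCompact {g : G | g • v = w} := by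
  by_cases h : ∃ g : G, g • v = w
  · obtain ⟨g, hg⟩ := h
    rw [transporter_eq_image hg]
    exact (hcomp v).image (continuous_const_mul g)
  · convert isCompact_empty
    ext x
    simp only [Set.mem_ofPred_eq, Set.mem_empty_iff_false, iff_false]
    exact fun hx => h ⟨x, hx⟩

/-- A discrete subgroup of a second countable group has a strict Borel fundamental domain. -/
lemma exists_strict_fundamentalDomain [SecondCountableTopology G] [MeasurableSpace G] [BorelSpace G]
    (Γ : Subgroup G) [DiscreteTopology Γ] :
    ∃ D : Set G, MeasurableSet D ∧ ∀ x : G, ∃! γ : Γ, γ • x ∈ D := by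
  -- an open set whose quotients meet `Γ` in the identity only
  obtain ⟨O, hO, hO1⟩ := isOpen_induced_iff.1 (isOpen_discrete ({1} : Set Γ))
  have hO1' : (1 : G) ∈ O := by
    have : (1 : Γ) ∈ Subtype.val ⁻¹' O := hO1 ▸ rfl
    simpa using this
  obtain ⟨U, hU, hU1, hUO⟩ : ∃ U : Set G, IsOpen U ∧ (1 : G) ∈ U ∧
      ∀ a ∈ U, ∀ b ∈ U, a * b⁻¹ ∈ O := by
    have h : (fun p : G × G => p.1 * p.2⁻¹) ⁻¹' O ∈ 𝓝 ((1 : G), (1 : G)) :=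
      ContinuousAt.preimage_mem_nhds (by fun_prop) (hO.mem_nhds (by simpa using hO1'))
    obtain ⟨U, W, hU, hU1, hW, hW1, hUW⟩ := mem_nhds_prod_iff'.1 h
    exact ⟨U ∩ W, hU.inter hW, ⟨hU1, hW1⟩, fun a ha b hb => hUW (Set.mk_mem_prod ha.1 hb.2)⟩
  have hcoverN : ∀ x : G, (fun y => y * x⁻¹) ⁻¹' U ∈ 𝓝 x := fun x =>
    (hU.preimage (continuous_mul_const x⁻¹)).mem_nhds (by simpa using hU1)
  obtain ⟨s, hs, hcover⟩ := TopologicalSpace.countable_cover_nhds hcoverN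
  have hsne : s.Nonempty := by
    by_contra h
    rw [Set.not_nonempty_iff_eq_empty] at h
    exact Set.empty_ne_univ (by simpa [h] using hcover)
  obtain ⟨a, ha⟩ := hs.exists_eq_range hsne
  let B : ℕ → Set G := fun i => (fun y => y * (a i)⁻¹) ⁻¹' U
  have hB : ∀ i, IsOpen (B i) := fun i => hU.preimage (continuous_mul_const _)
  have hBcover : ∀ x, ∃ i, x ∈ B i := fun x => by
    have hx : x ∈ ⋃ y ∈ s, (fun z => z * y⁻¹) ⁻¹' U := hcover ▸ Set.mem_univ x
    rw [ha] at hx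
    simpa [B] using hx
  have hBinj : ∀ i x (γ δ : Γ), γ • x ∈ B i → δ • x ∈ B i → γ = δ := by
    intro i x γ δ h1 h2
    have h3 := hUO _ h1 _ h2
    have h4 : γ * δ⁻¹ ∈ Subtype.val ⁻¹' O := by
      simpa [Subgroup.smul_def, mul_assoc] using h3
    rw [hO1] at h4
    exact mul_inv_eq_one.1 h4
  -- each orbit is represented in the first of the sets `B i` that it meets
  let A : ℕ → Set G := fun i => ⋃ γ : Γ, (fun x => γ • x) ⁻¹' B i
  have hA : ∀ i, IsOpen (A i) := fun i => isOpen_iUnion fun γ =>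
    (hB i).preimage (continuous_const_mul (γ : G))
  have hAinv : ∀ i x (γ : Γ), γ • x ∈ A i ↔ x ∈ A i := by
    intro i x γ
    simp only [A, Set.mem_iUnion, Set.mem_preimage]
    constructor
    · rintro ⟨δ, h⟩; exact ⟨δ * γ, by rwa [mul_smul]⟩
    · rintro ⟨δ, h⟩; exact ⟨δ * γ⁻¹, by rwa [mul_smul, inv_smul_smul]⟩
  have hBA : ∀ i, B i ⊆ A i := fun i x hx => Set.mem_iUnion.2 ⟨1, by simpa using hx⟩
  refine ⟨⋃ i, B i \ ⋃ j ∈ Set.Iio i, A j, MeasurableSet.iUnion fun i =>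
    (hB i).measurableSet.diff (isOpen_biUnion fun j _ => hA j).measurableSet, fun x => ?_⟩
  classical
  have hex : ∃ i, x ∈ A i := (hBcover x).imp fun i h => hBA i h
  have hmem : ∀ γ : Γ, γ • x ∈ (⋃ i, B i \ ⋃ j ∈ Set.Iio i, A j) ↔ γ • x ∈ B (Nat.find hex) := by
    intro γ
    simp only [Set.mem_iUnion, Set.mem_sdiff, not_exists, Set.mem_Iio]
    constructor
    · rintro ⟨i, h1, h2⟩
      have : Nat.find hex = i := by
        rw [Nat.find_eq_iff]
        exact ⟨(hAinv i x γ).1 (hBA i h1), fun j hj h => h2 j hj ((hAinv j x γ).2 h)⟩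
      rwa [this]
    · exact fun h => ⟨_, h, fun j hj h' => Nat.find_min hex hj ((hAinv j x γ).1 h')⟩
  obtain ⟨γ, hγ⟩ := Set.mem_iUnion.1 (Nat.find_spec hex)
  exact ⟨γ, (hmem γ).2 hγ, fun δ hδ => hBinj _ x δ γ ((hmem δ).1 hδ) hγ⟩

variable [T2Space G]

lemma finite_stabilizer_of_discrete
    (hcomp : ∀ v : V, IsCompact (MulAction.stabilizer G v : Set G)) (Γ : Subgroup G)
    [DiscreteTopology Γ] (v : V) : Finite (MulAction.stabilizer Γ v) := by
  have hcl : IsClosed (Γ : Set G) := Subgroup.isClosed_of_discrete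
  have h := hcl.tendsto_coe_cofinite_of_isDiscrete (SetLike.isDiscrete_iff_discreteTopology.2 ‹_›)
  have h2 := h (hcomp v).compl_mem_cocompact
  rw [Filter.mem_map, Filter.mem_cofinite] at h2
  refine Set.Finite.to_subtype (s := (MulAction.stabilizer Γ v : Set Γ)) (h2.subset ?_)
  intro γ hγ
  simpa [Subgroup.smul_def] using hγ

variable [SecondCountableTopology G] [MeasurableSpace G] [BorelSpace G]

/-- The part of a fundamental domain that moves `v` into the `Γ`-orbit of `w` has the measure of
the transporter from `v` to `w`, divided by `|Γ_w|`. -/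
lemma card_mul_measure_orbit [Countable V]
    (hopen : ∀ v : V, IsOpen (MulAction.stabilizer G v : Set G))
    (hcomp : ∀ v : V, IsCompact (MulAction.stabilizer G v : Set G))
    (μ : Measure G) [μ.IsMulLeftInvariant] (Γ : Subgroup G) [DiscreteTopology Γ] {D : Set G}
    (hD : IsFundamentalDomain Γ D μ) (v w : V) :
    (Nat.card (MulAction.stabilizer Γ w) : ℝ≥0∞) *
      μ.restrict D {x | x • v ∈ MulAction.orbit Γ w} = μ {x | x • v = w} := by
  have := countable_of_discrete Γ
  have := finite_stabilizer_of_discrete hcomp Γ w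
  have hm : ∀ u, MeasurableSet {x : G | x • v = u} := fun u =>
    (isOpen_transporter hopen v u).measurableSet
  have hmo : MeasurableSet {x : G | x • v ∈ MulAction.orbit Γ w} := by
    have : {x : G | x • v ∈ MulAction.orbit Γ w} =
        ⋃ u ∈ MulAction.orbit Γ w, {x | x • v = u} := by ext; simp
    rw [this]
    exact MeasurableSet.biUnion (Set.to_countable _) fun u _ => hm u
  calc (Nat.card (MulAction.stabilizer Γ w) : ℝ≥0∞) *
      μ.restrict D {x | x • v ∈ MulAction.orbit Γ w}
      = ∫⁻ x in D, {x | x • v ∈ MulAction.orbit Γ w}.indicator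
          (fun _ => (Nat.card (MulAction.stabilizer Γ w) : ℝ≥0∞)) x ∂μ := by
        rw [lintegral_indicator_const hmo]
    _ = ∫⁻ x in D, ∑' γ : Γ, ({x • v} : Set V).indicator (1 : V → ℝ≥0∞) (γ • w) ∂μ := by
        refine lintegral_congr fun x => ?_
        exact (tsum_smul_eq w (x • v)).symm
    _ = ∑' γ : Γ, ∫⁻ x in D, {x : G | x • v = γ • w}.indicator 1 x ∂μ := by
        rw [← lintegral_tsum fun γ => (measurable_one.indicator (hm _)).aemeasurable]
        refine lintegral_congr fun x => tsum_congr fun γ => ?_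
        classical
        simp only [Set.indicator_apply, Set.mem_singleton_iff, Set.mem_ofPred_eq, Pi.one_apply]
        exact if_congr eq_comm rfl rfl
    _ = ∑' γ : Γ, μ ({x : G | x • v = γ • w} ∩ D) := by
        refine tsum_congr fun γ => ?_
        rw [lintegral_indicator_one (hm _), Measure.restrict_apply (hm _)]
    _ = μ {x | x • v = w} := by
        rw [hD.measure_eq_tsum]
        refine tsum_congr fun γ => ?_
        congr 2
        ext x
        rw [Set.mem_smul_set_iff_inv_smul_mem]
        simp only [Set.mem_ofPred_eq, Subgroup.smul_def, smul_eq_mul, mul_smul]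
        exact (inv_smul_eq_iff (g := (γ : G))).symm

/-- The measure of a fundamental domain of `Γ`, computed from the `Γ`-orbits in one `G`-orbit. -/
lemma measure_fundamentalDomain [Countable V]
    (hopen : ∀ v : V, IsOpen (MulAction.stabilizer G v : Set G))
    (hcomp : ∀ v : V, IsCompact (MulAction.stabilizer G v : Set G))
    (μ : Measure G) [μ.IsMulLeftInvariant] (Γ : Subgroup G) [DiscreteTopology Γ] {D : Set G}
    (hD : IsFundamentalDomain Γ D μ) (v : V) :
    μ D = μ (MulAction.stabilizer G v) * ∑' x : MulAction.orbitRel.Quotient Γ V,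
      (MulAction.orbit G v).indicator
        (fun w => ((Nat.card (MulAction.stabilizer Γ w) : ℝ≥0∞))⁻¹) x.out := by
  have hm : ∀ x : MulAction.orbitRel.Quotient Γ V,
      MeasurableSet {g : G | g • v ∈ MulAction.orbit Γ x.out} := fun x => by
    have : {g : G | g • v ∈ MulAction.orbit Γ x.out} =
        ⋃ u ∈ MulAction.orbit Γ x.out, {g | g • v = u} := by ext; simp
    rw [this]
    exact MeasurableSet.biUnion (Set.to_countable _) fun u _ =>
      (isOpen_transporter hopen v u).measurableSet
  have hmk : ∀ (x : MulAction.orbitRel.Quotient Γ V) (u : V),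
      u ∈ MulAction.orbit Γ x.out ↔ (⟦u⟧ : MulAction.orbitRel.Quotient Γ V) = x := by
    intro x u
    rw [← MulAction.orbitRel_apply]
    conv_rhs => rw [← Quotient.out_eq x]
    exact Quotient.eq.symm
  have hunion : (⋃ x : MulAction.orbitRel.Quotient Γ V,
      {g : G | g • v ∈ MulAction.orbit Γ x.out}) = Set.univ := by
    refine Set.eq_univ_of_forall fun g => Set.mem_iUnion.2 ⟨⟦g • v⟧, ?_⟩
    exact (hmk _ _).2 rfl
  have hcount : Countable (MulAction.orbitRel.Quotient Γ V) :=
    Quotient.mk_surjective.countable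
  have h1 : μ D = ∑' x : MulAction.orbitRel.Quotient Γ V,
      μ.restrict D {g : G | g • v ∈ MulAction.orbit Γ x.out} := by
    rw [← measure_iUnion _ hm, hunion, Measure.restrict_apply_univ]
    intro x y hxy
    refine Set.disjoint_left.2 fun g hx hy => hxy ?_
    exact ((hmk _ _).1 hx).symm.trans ((hmk _ _).1 hy)
  rw [h1, ← ENNReal.tsum_mul_left]
  refine tsum_congr fun x => ?_
  have hfin := finite_stabilizer_of_discrete hcomp Γ x.out
  have h2 := card_mul_measure_orbit hopen hcomp μ Γ hD v x.out
  have hcard : (Nat.card (MulAction.stabilizer Γ x.out) : ℝ≥0∞) ≠ 0 := by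
    exact_mod_cast Nat.card_pos.ne'
  have h3 : μ.restrict D {g : G | g • v ∈ MulAction.orbit Γ x.out} =
      μ {g | g • v = x.out} * (Nat.card (MulAction.stabilizer Γ x.out) : ℝ≥0∞)⁻¹ := by
    rw [← h2, mul_comm, ← mul_assoc, ENNReal.inv_mul_cancel hcard (ENNReal.natCast_ne_top _),
      one_mul]
  rw [h3]
  by_cases hx : x.out ∈ MulAction.orbit G v
  · rw [Set.indicator_of_mem hx]
    obtain ⟨g, hg⟩ := hx
    rw [transporter_eq_image hg, Set.image_mul_left, measure_preimage_mul]
  · rw [Set.indicator_of_notMem hx, mul_zero]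
    have : {g : G | g • v = x.out} = ∅ := by
      ext g
      simp only [Set.mem_ofPred_eq, Set.mem_empty_iff_false, iff_false]
      exact fun h => hx ⟨g, h⟩
    rw [this, measure_empty, zero_mul]

/-- The normalised Haar measure exists if `V` consists of finitely many `G`-orbits with compact
open point stabilisers: the sum of the inverses of the measures of the stabilisers of
representatives has to be `1`. -/
theorem exists_isNormalizedHaar [Countable V] [Nonempty V]
    [Finite (MulAction.orbitRel.Quotient G V)]
    (hopen : ∀ v : V, IsOpen (MulAction.stabilizer G v : Set G))
    (hcomp : ∀ v : V, IsCompact (MulAction.stabilizer G v : Set G)) :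
    ∃ μ : Measure G, IsNormalizedHaar V μ := by
  obtain ⟨v₀⟩ := ‹Nonempty V›
  have : LocallyCompactSpace G := (hcomp v₀).locallyCompactSpace_of_mem_nhds_of_group
    ((hopen v₀).mem_nhds (one_mem (MulAction.stabilizer G v₀)))
  let h : Measure G := Measure.haar
  have hpos : ∀ v : V, h (MulAction.stabilizer G v) ≠ 0 := fun v =>
    (hopen v).measure_ne_zero h ⟨1, one_mem (MulAction.stabilizer G v)⟩
  have hlt : ∀ v : V, h (MulAction.stabilizer G v) ≠ ∞ := fun v => (hcomp v).measure_ne_top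
  have := Fintype.ofFinite (MulAction.orbitRel.Quotient G V)
  let c : ℝ≥0∞ := ∑ o : MulAction.orbitRel.Quotient G V, (h (MulAction.stabilizer G o.out))⁻¹
  have hc0 : c ≠ 0 := by
    intro hc
    have := Finset.sum_eq_zero_iff.1 hc ⟦v₀⟧ (Finset.mem_univ _)
    exact hlt _ (ENNReal.inv_eq_zero.1 this)
  have hct : c ≠ ∞ := ENNReal.sum_ne_top.2 fun o _ => ENNReal.inv_ne_top.2 (hpos _)
  refine ⟨c • h, ⟨Measure.IsHaarMeasure.smul h hc0 hct, fun Γ hΓ => ?_,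
    fun Γ hΓ => finite_stabilizer_of_discrete hcomp Γ, fun Γ hΓ => ?_⟩⟩
  · obtain ⟨D, hDm, hD⟩ := exists_strict_fundamentalDomain Γ
    exact ⟨D, IsFundamentalDomain.mk' hDm.nullMeasurableSet hD⟩
  · obtain ⟨D, hDm, hD⟩ := exists_strict_fundamentalDomain Γ
    have hDh : IsFundamentalDomain Γ D h := IsFundamentalDomain.mk' hDm.nullMeasurableSet hD
    have hDc : IsFundamentalDomain Γ D (c • h) :=
      IsFundamentalDomain.mk' hDm.nullMeasurableSet hD
    have := countable_of_discrete Γ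
    have := Measure.IsHaarMeasure.smul h hc0 hct
    rw [hDc.covolume_eq_volume, Measure.smul_apply, smul_eq_mul, Finset.sum_mul]
    have key : ∀ o : MulAction.orbitRel.Quotient G V, (h (MulAction.stabilizer G o.out))⁻¹ * h D =
        ∑' x : MulAction.orbitRel.Quotient Γ V, (MulAction.orbit G o.out).indicator
          (fun w => ((Nat.card (MulAction.stabilizer Γ w) : ℝ≥0∞))⁻¹) x.out := fun o => by
      rw [measure_fundamentalDomain hopen hcomp h Γ hDh o.out, ← mul_assoc,
        ENNReal.inv_mul_cancel (hpos _) (hlt _), one_mul]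
    simp_rw [key]
    rw [← tsum_fintype (L := .unconditional _), ENNReal.tsum_comm]
    refine tsum_congr fun x => ?_
    rw [tsum_eq_single (⟦x.out⟧ : MulAction.orbitRel.Quotient G V)]
    · refine Set.indicator_of_mem ?_ _
      rw [← MulAction.orbitRel_apply]
      exact Quotient.eq.1 (Quotient.out_eq _).symm
    · intro o ho
      refine Set.indicator_of_notMem (fun hmem => ho ?_) _
      rw [← MulAction.orbitRel_apply] at hmem
      rw [← Quotient.out_eq o]
      exact (Quotient.sound hmem).symm

end Covolume

/-! ### A criterion for uniform lattices -/

section Lattice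

open scoped Topology

variable {G V : Type*} [Group G] [MulAction G V] [TopologicalSpace G] [IsTopologicalGroup G]

/-- If `Γ` has finitely many orbits on `V`, the finitely many compact transporters from `v` to
representatives of these orbits cover the quotient `Γ \ G`. -/
lemma compactSpace_leftQuotient {v : V}
    (hcomp : ∀ v : V, IsCompact (MulAction.stabilizer G v : Set G)) (Γ : Subgroup G)
    [Finite (MulAction.orbitRel.Quotient Γ V)] : CompactSpace (LeftQuotient Γ) := by
  refine ⟨?_⟩
  have h : IsCompact (⋃ x : MulAction.orbitRel.Quotient Γ V,
      (Quotient.mk _ : G → LeftQuotient Γ) '' {g : G | g • v = x.out}) :=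
    isCompact_iUnion fun x => (isCompact_transporter hcomp v x.out).image continuous_quotient_mk'
  convert h
  refine (Set.eq_univ_of_forall fun y => ?_).symm
  induction y using Quotient.inductionOn with | _ g => ?_
  obtain ⟨γ, hγ⟩ : (⟦g • v⟧ : MulAction.orbitRel.Quotient Γ V).out ∈ MulAction.orbit Γ (g • v) := by
    rw [← MulAction.orbitRel_apply]
    exact Quotient.eq.1 (Quotient.out_eq _)
  refine Set.mem_iUnion.2 ⟨⟦g • v⟧, γ • g, ?_, Quotient.sound ⟨γ, rfl⟩⟩
  change (γ • g) • v = _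
  rw [← hγ, Subgroup.smul_def, smul_eq_mul, mul_smul]
  rfl

/-- A subgroup that meets an open point stabiliser in a finite set is discrete. -/
lemma discreteTopology_of_finite_stabilizer [T2Space G] {v : V}
    (hopen : IsOpen (MulAction.stabilizer G v : Set G)) (Γ : Subgroup G)
    [hfin : Finite (MulAction.stabilizer Γ v)] : DiscreteTopology Γ := by
  refine discreteTopology_of_isOpen_singleton_one ?_
  have h1 : IsOpen (MulAction.stabilizer Γ v : Set Γ) := hopen.preimage continuous_subtype_val
  have h2 : (MulAction.stabilizer Γ v : Set Γ).Finite := Set.toFinite _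
  have h3 : ({1} : Set Γ) =
      (MulAction.stabilizer Γ v : Set Γ) \ ((MulAction.stabilizer Γ v : Set Γ) \ {1}) := by
    rw [Set.sdiff_sdiff_right_self]
    ext γ
    simp only [Set.mem_singleton_iff, Set.mem_inter_iff, SetLike.mem_coe]
    exact ⟨fun h => ⟨h ▸ one_mem _, h⟩, fun h => h.2⟩
  rw [h3]
  exact h1.sdiff (h2.subset Set.sdiff_subset).isClosed

variable [SecondCountableTopology G] [MeasurableSpace G] [BorelSpace G]

/-- A locally compact group that has a discrete subgroup of finite covolume is unimodular:
right translates of fundamental domains are fundamental domains, hence of equal measure. -/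
lemma isMulRightInvariant_of_fundamentalDomain [LocallyCompactSpace G] (μ : Measure G)
    [μ.IsHaarMeasure] (Γ : Subgroup G) [Countable Γ] {D : Set G} (hDm : MeasurableSet D)
    (hD : ∀ x : G, ∃! γ : Γ, γ • x ∈ D) (hfin : μ D ≠ ∞) : μ.IsMulRightInvariant := by
  refine ⟨fun g => ?_⟩
  have hfund : IsFundamentalDomain Γ D μ := IsFundamentalDomain.mk' hDm.nullMeasurableSet hD
  have hm : Measurable (fun x : G => x * g) := (continuous_mul_const g).measurable
  have hfund' : IsFundamentalDomain Γ ((fun x => x * g) ⁻¹' D) μ :=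
    IsFundamentalDomain.mk' (hm hDm).nullMeasurableSet fun x => by
      simpa [Subgroup.smul_def, mul_assoc] using hD (x * g)
  have hhaar : (μ.map (fun x => x * g)).IsHaarMeasure := Measure.isHaarMeasure_map_mul_right μ g
  have h1 := Measure.isMulLeftInvariant_eq_smul (μ.map (fun x => x * g)) μ
  set c := Measure.haarScalarFactor (μ.map (fun x => x * g)) μ
  have h2 : μ D = c * μ D := by
    conv_lhs => rw [hfund.measure_eq hfund', ← Measure.map_apply hm hDm, h1]
    rfl
  have h3 : μ D ≠ 0 := hfund.measure_ne_zero (NeZero.ne μ)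
  have h4 : (c : ℝ≥0∞) = 1 := by
    have := (ENNReal.mul_left_inj h3 hfin).1 ((one_mul (μ D)).trans h2)
    exact this.symm
  rw [h1, show c = 1 by exact_mod_cast h4, one_smul]

/-- A discrete subgroup with a fundamental domain of finite measure is a lattice: push the
restriction of Haar measure to a fundamental domain forward to the quotient. -/
lemma exists_invariant_measure [LocallyCompactSpace G] (μ : Measure G)
    [μ.IsHaarMeasure] (Γ : Subgroup G) [Countable Γ] {D : Set G} (hDm : MeasurableSet D)
    (hD : ∀ x : G, ∃! γ : Γ, γ • x ∈ D) (hfin : μ D ≠ ∞) :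
    ∃ ν : Measure (LeftQuotient Γ), ν ≠ 0 ∧ IsFiniteMeasure ν ∧
      ∀ g : G, ν.map (rightTranslate Γ g) = ν := by
  have := isMulRightInvariant_of_fundamentalDomain μ Γ hDm hD hfin
  have hfund : IsFundamentalDomain Γ D μ := IsFundamentalDomain.mk' hDm.nullMeasurableSet hD
  let π : G → LeftQuotient Γ := Quotient.mk (MulAction.orbitRel Γ G)
  have hπ : Measurable π := measurable_quotient_mk''
  have hr : ∀ g : G, Measurable (fun x : G => x * g) := fun g =>
    (continuous_mul_const g).measurable
  have hR : ∀ g : G, Measurable (rightTranslate Γ g) := fun g =>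
    measurable_from_quotient.2 (hπ.comp (hr g))
  have hν : ∀ A : Set (LeftQuotient Γ), MeasurableSet A →
      (μ.restrict D).map π A = μ (π ⁻¹' A ∩ D) := fun A hA => by
    rw [Measure.map_apply hπ hA, Measure.restrict_apply (hπ hA)]
  refine ⟨(μ.restrict D).map π, fun h => ?_, ⟨?_⟩, fun g => ?_⟩
  · have h0 := hν Set.univ MeasurableSet.univ
    rw [h] at h0
    simp only [Measure.coe_zero, Pi.zero_apply, Set.preimage_univ, Set.univ_inter] at h0
    exact hfund.measure_ne_zero (NeZero.ne μ) h0.symm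
  · rw [hν _ MeasurableSet.univ, Set.preimage_univ, Set.univ_inter]
    exact hfin.lt_top
  · ext A hA
    rw [Measure.map_apply (hR g) hA, hν _ (hR g hA), hν _ hA]
    have hfund' : IsFundamentalDomain Γ ((fun x => x * g⁻¹) ⁻¹' D) μ :=
      IsFundamentalDomain.mk' (hr _ hDm).nullMeasurableSet fun x => by
        simpa [Subgroup.smul_def, mul_assoc] using hD (x * g⁻¹)
    have h1 := hfund.measure_set_eq hfund' (A := π ⁻¹' A) (hπ hA) (fun γ => by
      ext x
      exact iff_of_eq (congrArg (· ∈ A) (Quotient.sound ⟨γ, rfl⟩)))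
    rw [h1, ← measure_preimage_mul_right μ g (π ⁻¹' A ∩ _)]
    congr 1
    ext x
    simp only [Set.mem_inter_iff, Set.mem_preimage, mul_inv_cancel_right]
    rfl

/-- A subgroup with finitely many orbits on `V` and a finite point stabiliser is a uniform
lattice, if `V` is a `G`-set with compact open point stabilisers. -/
theorem isUniformLattice_of_finite [T2Space G] [Countable V]
    (hopen : ∀ v : V, IsOpen (MulAction.stabilizer G v : Set G))
    (hcomp : ∀ v : V, IsCompact (MulAction.stabilizer G v : Set G)) (Γ : Subgroup G) (v : V)
    [Finite (MulAction.stabilizer Γ v)] [Finite (MulAction.orbitRel.Quotient Γ V)] :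
    IsUniformLattice Γ := by
  have hdisc := discreteTopology_of_finite_stabilizer (hopen v) Γ
  have := countable_of_discrete Γ
  have : LocallyCompactSpace G := (hcomp v).locallyCompactSpace_of_mem_nhds_of_group
    ((hopen v).mem_nhds (one_mem (MulAction.stabilizer G v)))
  obtain ⟨D, hDm, hD⟩ := exists_strict_fundamentalDomain Γ
  refine ⟨⟨hdisc, exists_invariant_measure (Measure.haar : Measure G) Γ hDm hD ?_⟩,
    compactSpace_leftQuotient (v := v) hcomp Γ⟩
  rw [measure_fundamentalDomain hopen hcomp Measure.haar Γ
    (IsFundamentalDomain.mk' hDm.nullMeasurableSet hD) v]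
  have := Fintype.ofFinite (MulAction.orbitRel.Quotient Γ V)
  refine ENNReal.mul_ne_top (hcomp v).measure_ne_top ?_
  rw [tsum_fintype]
  refine ENNReal.sum_ne_top.2 fun x _ => ?_
  have := finite_stabilizer_of_discrete hcomp Γ x.out
  refine ne_top_of_le_ne_top ?_ (Set.indicator_le_self _ _ _)
  exact ENNReal.inv_ne_top.2 (by exact_mod_cast Nat.card_pos.ne')

end Lattice

/-! ### A finite graph with many automorphisms of order `p` -/

section Necklace

variable (m p q : ℕ)

/-- The vertices of the subdivision of the necklace: the beads `(i, e)`, with `i` modulo `m` and a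
sign `e`, and one vertex in the middle of each string. For `m = 0` the chain of beads is infinite. -/
abbrev NecklaceVertex : Type :=
  (ZMod m × Bool) ⊕ (ZMod m × (Fin p ⊕ Fin q))

variable {m p q}

/-- The index of the end of sign `e` of a string. The `p` strings `(i, inl j)` join `(i, true)` to
`(i, false)`; the `q` strings `(i, inr j)` join `(i, true)` to `(i + 1, false)`. -/
def stringEnd (e : Bool) (b : ZMod m × (Fin p ⊕ Fin q)) : ZMod m :=
  match e, b with
  | true, (i, _) => i
  | false, (i, Sum.inl _) => i
  | false, (i, Sum.inr _) => i + 1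

variable (m p q)

/-- The subdivision of the necklace: a closed chain of `2 * m` beads in which neighbouring beads
are joined by `p` and by `q` strings alternately. -/
def necklace : SimpleGraph (NecklaceVertex m p q) where
  Adj x y := match x, y with
    | Sum.inl (i, e), Sum.inr b => stringEnd e b = i
    | Sum.inr b, Sum.inl (i, e) => stringEnd e b = i
    | _, _ => False
  symm := ⟨by rintro (⟨i, e⟩ | b) (⟨i', e'⟩ | b') h <;> exact h⟩
  loopless := ⟨by rintro (⟨i, e⟩ | b) h <;> exact h⟩

variable {m p q}

/-- Beads are `true`, the middles of strings are `false`. -/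
def necklaceColoring : (necklace m p q).Coloring Bool :=
  SimpleGraph.Coloring.mk Sum.isLeft (by
    rintro (⟨i, e⟩ | b) (⟨i', e'⟩ | b') h
    · exact h.elim
    · simp
    · simp
    · exact h.elim)

lemma encard_neighborSet_bead (i : ZMod m) (e : Bool) :
    ((necklace m p q).neighborSet (Sum.inl (i, e))).encard = (p + q : ℕ) := by
  -- the strings at a bead are the strings `(k s, s)`, where `s` ranges over their types
  let k : Fin p ⊕ Fin q → ZMod m := fun s => match e, s with
    | true, _ => i
    | false, Sum.inl _ => i
    | false, Sum.inr _ => i - 1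
  have h : (necklace m p q).neighborSet (Sum.inl (i, e)) =
      Set.range (fun s => (Sum.inr (k s, s) : NecklaceVertex m p q)) := by
    ext x
    rcases x with ⟨i', e'⟩ | ⟨i', s⟩
    · simp [necklace]
    · simp only [SimpleGraph.mem_neighborSet, Set.mem_range, Sum.inr.injEq, Prod.mk.injEq,
        exists_eq_right]
      cases e <;> rcases s with s | s
      · exact eq_comm
      · exact eq_comm.trans (sub_eq_iff_eq_add.symm)
      · exact eq_comm
      · exact eq_comm
  rw [h, ← Set.image_univ, Function.Injective.encard_image, Set.encard_univ]
  · simp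
  · intro s t hst
    simpa using (Prod.mk.inj (Sum.inr.inj hst)).2

lemma encard_neighborSet_string (b : ZMod m × (Fin p ⊕ Fin q)) :
    ((necklace m p q).neighborSet (Sum.inr b)).encard = 2 := by
  have h : (necklace m p q).neighborSet (Sum.inr b) =
      Set.range (fun e => (Sum.inl (stringEnd e b, e) : NecklaceVertex m p q)) := by
    ext x
    rcases x with ⟨i', e'⟩ | b'
    · simp only [SimpleGraph.mem_neighborSet, Set.mem_range, Sum.inl.injEq, Prod.mk.injEq,
        exists_eq_right]
      rfl
    · simp [necklace]
  rw [h, ← Set.image_univ, Function.Injective.encard_image, Set.encard_univ]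
  · simp
  · intro s t hst
    simpa using (Prod.mk.inj (Sum.inl.inj hst)).2

lemma necklace_connected [NeZero m] (hp : 0 < p) (hq : 0 < q) : (necklace m p q).Connected := by
  let v : NecklaceVertex m p q := Sum.inl (0, true)
  have h1 : ∀ i : ZMod m, (necklace m p q).Reachable (Sum.inl (i, true)) (Sum.inl (i, false)) :=
    fun i => SimpleGraph.Reachable.trans (v := Sum.inr (i, Sum.inl ⟨0, hp⟩))
      (SimpleGraph.Adj.reachable rfl) (SimpleGraph.Adj.reachable rfl)
  have h2 : ∀ i : ZMod m, (necklace m p q).Reachable (Sum.inl (i, true))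
      (Sum.inl (i + 1, false)) :=
    fun i => SimpleGraph.Reachable.trans (v := Sum.inr (i, Sum.inr ⟨0, hq⟩))
      (SimpleGraph.Adj.reachable rfl) (SimpleGraph.Adj.reachable rfl)
  have h3 : ∀ k : ℕ, (necklace m p q).Reachable v (Sum.inl ((k : ZMod m), true)) := by
    intro k
    induction k with
    | zero => simp [v]
    | succ k ih =>
      push_cast
      exact ih.trans ((h2 k).trans (h1 _).symm)
  have h4 : ∀ i : ZMod m, (necklace m p q).Reachable v (Sum.inl (i, true)) := fun i => by
    simpa using h3 i.val
  have h5 : ∀ x, (necklace m p q).Reachable v x := by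
    rintro (⟨i, _ | _⟩ | ⟨i, s⟩)
    · exact (h4 i).trans (h1 i)
    · exact h4 i
    · exact (h4 i).trans (SimpleGraph.Adj.reachable rfl)
  exact { preconnected := fun x y => (h5 x).symm.trans (h5 y), nonempty := ⟨v⟩ }

/-- The permutation of the strings that permutes, for each `i`, the `p` strings between `(i, true)`
and `(i, false)` among themselves. -/
def permuteStrings (σ : ZMod m → Equiv.Perm (Fin p)) (b : ZMod m × (Fin p ⊕ Fin q)) :
    ZMod m × (Fin p ⊕ Fin q) :=
  (b.1, Sum.map (σ b.1) id b.2)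

lemma permuteStrings_mul (σ τ : ZMod m → Equiv.Perm (Fin p)) (b : ZMod m × (Fin p ⊕ Fin q)) :
    permuteStrings (σ * τ) b = permuteStrings σ (permuteStrings τ b) := by
  rcases b with ⟨i, s | s⟩ <;> rfl

lemma permuteStrings_one (b : ZMod m × (Fin p ⊕ Fin q)) : permuteStrings 1 b = b := by
  rcases b with ⟨i, s | s⟩ <;> rfl

lemma stringEnd_permuteStrings (σ : ZMod m → Equiv.Perm (Fin p)) (e : Bool)
    (b : ZMod m × (Fin p ⊕ Fin q)) : stringEnd e (permuteStrings σ b) = stringEnd e b := by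
  rcases b with ⟨i, s | s⟩ <;> cases e <;> rfl

/-- Permutations of the `p` parallel strings act on the necklace by automorphisms. -/
def permuteStringsHom :
    (ZMod m → Equiv.Perm (Fin p)) →* (necklace m p q ≃g necklace m p q) where
  toFun σ :=
    { toFun := Sum.map id (permuteStrings σ)
      invFun := Sum.map id (permuteStrings σ⁻¹)
      left_inv := by
        rintro (x | b)
        · rfl
        · simp [← permuteStrings_mul, permuteStrings_one]
      right_inv := by
        rintro (x | b)
        · rfl
        · simp [← permuteStrings_mul, permuteStrings_one]
      map_rel_iff' := by
        rintro (⟨i, e⟩ | b) (⟨i', e'⟩ | b') <;> simp [necklace, stringEnd_permuteStrings] }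
  map_one' := by
    ext x
    rcases x with x | b
    · rfl
    · exact congrArg Sum.inr (permuteStrings_one b)
  map_mul' σ τ := by
    ext x
    rcases x with x | b
    · rfl
    · exact congrArg Sum.inr (permuteStrings_mul σ τ b)

lemma permuteStringsHom_injective :
    Function.Injective (permuteStringsHom (m := m) (p := p) (q := q)) := by
  intro σ τ h
  funext i
  ext j
  have h1 : (Sum.inr (permuteStrings σ (i, Sum.inl j)) : NecklaceVertex m p q) =
      Sum.inr (permuteStrings τ (i, Sum.inl j)) := DFunLike.congr_fun h (Sum.inr (i, Sum.inl j))
  have h2 := Sum.inl.inj (Prod.mk.inj (Sum.inr.inj h1)).2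
  exact congrArg Fin.val h2

lemma card_necklaceVertex [NeZero m] : Nat.card (NecklaceVertex m p q) = m * (p + q + 2) := by
  simp [NecklaceVertex, Nat.card_eq_fintype_card, ZMod.card]
  ring

instance [NeZero m] : Finite (necklace m p q ≃g necklace m p q) :=
  Finite.of_injective (fun g (x : NecklaceVertex m p q) => g x) DFunLike.coe_injective

lemma pow_dvd_card_aut_necklace [NeZero m] (hp : 0 < p) :
    p ^ m ∣ Nat.card (necklace m p q ≃g necklace m p q) := by
  have h1 : Nat.card (ZMod m → Equiv.Perm (Fin p)) ∣
      Nat.card (necklace m p q ≃g necklace m p q) :=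
    Subgroup.card_dvd_of_injective _ permuteStringsHom_injective
  refine dvd_trans ?_ h1
  rw [Nat.card_fun, Nat.card_zmod, Nat.card_perm, Nat.card_fin]
  exact pow_dvd_pow_of_dvd (Nat.dvd_factorial hp le_rfl) m

end Necklace

/-! ### Lifts of the automorphisms of a finite graph -/

section LiftGroup

variable {V W : Type*} {T : SimpleGraph V} {X : SimpleGraph W}

/-- The group of all automorphisms of the source of `π` that lift an automorphism of the target.
If `π` is the covering of a finite connected graph by a tree, it is an extension of the
automorphism group of the graph by its fundamental group. -/
def liftGroup (T : SimpleGraph V) (X : SimpleGraph W) (π : V → W) : Subgroup (T ≃g T) where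
  carrier := {g | ∃ h : X ≃g X, ∀ v, π (g v) = h (π v)}
  one_mem' := ⟨1, fun _ => rfl⟩
  mul_mem' := by
    rintro g g' ⟨h, hg⟩ ⟨h', hg'⟩
    exact ⟨h * h', fun v => (hg (g' v)).trans (congrArg h (hg' v))⟩
  inv_mem' := by
    rintro g ⟨h, hg⟩
    refine ⟨h⁻¹, fun v => ?_⟩
    have h1 := hg (g⁻¹ v)
    rw [RelIso.apply_inv_self] at h1
    rw [h1]
    exact (RelIso.inv_apply_self h _).symm

variable {π : V → W}

/-- Each automorphism of the covered graph lifts, with a prescribed value at one vertex. -/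
lemma exists_lift_of_aut (hT : T.IsTree) (hπ : IsCovering T X π) (h : X ≃g X) {v w : V}
    (hvw : h (π v) = π w) : ∃ g : T ≃g T, g v = w ∧ ∀ u, π (g u) = h (π u) :=
  exists_iso_of_covering hT hT ((IsCovering.of_iso h).comp hπ) hπ hvw

/-- A point stabiliser in the group of lifts maps bijectively to a point stabiliser in the
automorphism group of the covered graph. -/
lemma nonempty_stabilizer_equiv (hT : T.IsTree) (hX : X.Connected) (hπ : IsCovering T X π)
    (v : V) : Nonempty (MulAction.stabilizer (X ≃g X) (π v) ≃
      MulAction.stabilizer (liftGroup T X π) v) := by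
  have : Nonempty V := ⟨v⟩
  have hsurj := hπ.surjective hX
  choose l hl hlπ using fun h : MulAction.stabilizer (X ≃g X) (π v) =>
    exists_lift_of_aut hT hπ h.1 (v := v) (w := v) h.2
  refine ⟨Equiv.ofBijective (fun h => ⟨⟨l h, h.1, hlπ h⟩, hl h⟩) ⟨fun h h' hh => ?_, ?_⟩⟩
  · have h1 : l h = l h' := congrArg (fun g => g.1.1) hh
    refine Subtype.ext (RelIso.ext fun x => ?_)
    obtain ⟨u, rfl⟩ := hsurj x
    rw [← hlπ h, ← hlπ h', h1]
  · rintro ⟨⟨g, h, hg⟩, hgv⟩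
    have hgv' : g v = v := hgv
    have hh : h (π v) = π v := by rw [← hg, hgv']
    refine ⟨⟨h, hh⟩, Subtype.ext (Subtype.ext (DFunLike.coe_injective ?_))⟩
    exact hπ.lift_unique hT.connected (fun _ _ e => (l ⟨h, hh⟩).map_adj_iff.2 e)
      (fun _ _ e => g.map_adj_iff.2 e) (fun u => (hlπ ⟨h, hh⟩ u).trans (hg u).symm)
      (v₀ := v) ((hl ⟨h, hh⟩).trans hgv'.symm)

/-- The orbits of the group of lifts on the tree correspond to the orbits of the automorphism group
of the covered graph. -/
lemma exists_orbit_equiv (hT : T.IsTree) (hX : X.Connected) (hπ : IsCovering T X π) :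
    ∃ e : MulAction.orbitRel.Quotient (liftGroup T X π) V ≃
      MulAction.orbitRel.Quotient (X ≃g X) W, ∀ v, e ⟦v⟧ = ⟦π v⟧ := by
  have : Nonempty V := hT.connected.nonempty
  let e : MulAction.orbitRel.Quotient (liftGroup T X π) V →
      MulAction.orbitRel.Quotient (X ≃g X) W := Quotient.map π (by
    rintro _ w ⟨⟨g, h, hg⟩, rfl⟩
    exact ⟨h, (hg w).symm⟩)
  refine ⟨Equiv.ofBijective e ⟨?_, ?_⟩, fun v => rfl⟩
  · intro x y
    induction x using Quotient.inductionOn with | _ v => ?_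
    induction y using Quotient.inductionOn with | _ w => ?_
    intro h
    obtain ⟨a, ha⟩ := Quotient.exact h
    obtain ⟨g, hg, hga⟩ := exists_lift_of_aut hT hπ a ha
    exact Quotient.sound ⟨⟨g, a, hga⟩, hg⟩
  · intro y
    induction y using Quotient.inductionOn with | _ x => ?_
    obtain ⟨v, rfl⟩ := hπ.surjective hX x
    exact ⟨⟦v⟧, rfl⟩

/-- The mass formula for the group of lifts: the orbits correspond to those of `Aut X` on the
finite graph `X`, which contribute their lengths divided by `|Aut X|`. -/
lemma tsum_inv_card_stabilizer_liftGroup [Finite W] (hT : T.IsTree)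
    (hX : X.Connected) (hπ : IsCovering T X π) :
    ∑' x : MulAction.orbitRel.Quotient (liftGroup T X π) V,
      ((Nat.card (MulAction.stabilizer (liftGroup T X π) x.out) : ℝ≥0∞))⁻¹ =
      (Nat.card W : ℝ≥0∞) / (Nat.card (X ≃g X) : ℝ≥0∞) := by
  obtain ⟨e, he⟩ := exists_orbit_equiv hT hX hπ
  have hfinH : Finite (X ≃g X) :=
    Finite.of_injective (fun g (x : W) => g x) DFunLike.coe_injective
  have := Fintype.ofFinite (MulAction.orbitRel.Quotient (X ≃g X) W)
  have key : ∀ x : MulAction.orbitRel.Quotient (liftGroup T X π) V,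
      ((Nat.card (MulAction.stabilizer (liftGroup T X π) x.out) : ℝ≥0∞))⁻¹ =
        (Nat.card (MulAction.orbitRel.Quotient.orbit (e x)) : ℝ≥0∞) *
          (Nat.card (X ≃g X) : ℝ≥0∞)⁻¹ := by
    intro x
    obtain ⟨k⟩ := nonempty_stabilizer_equiv hT hX hπ x.out
    have hex : e x = ⟦π x.out⟧ := by rw [← he, Quotient.out_eq]
    have hor : MulAction.orbitRel.Quotient.orbit (e x) = MulAction.orbit (X ≃g X) (π x.out) := by
      rw [hex]; exact MulAction.orbitRel.Quotient.orbit_mk _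
    have hcard : Nat.card (MulAction.orbit (X ≃g X) (π x.out)) *
        Nat.card (MulAction.stabilizer (X ≃g X) (π x.out)) = Nat.card (X ≃g X) := by
      rw [← Nat.card_prod]
      exact Nat.card_congr (MulAction.orbitProdStabilizerEquivGroup _ _)
    rw [hor, ← Nat.card_congr k, ← hcard]
    have h1 : (Nat.card (MulAction.orbit (X ≃g X) (π x.out)) : ℝ≥0∞) ≠ 0 := by
      have : Nonempty (MulAction.orbit (X ≃g X) (π x.out)) := ⟨⟨_, MulAction.mem_orbit_self _⟩⟩
      exact_mod_cast Nat.card_pos.ne'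
    rw [Nat.cast_mul, ENNReal.mul_inv (Or.inl h1) (Or.inl (ENNReal.natCast_ne_top _)), ← mul_assoc,
      ENNReal.mul_inv_cancel h1 (ENNReal.natCast_ne_top _), one_mul]
  simp_rw [key]
  rw [e.tsum_eq (fun y => (Nat.card (MulAction.orbitRel.Quotient.orbit y) : ℝ≥0∞) *
    (Nat.card (X ≃g X) : ℝ≥0∞)⁻¹), ENNReal.tsum_mul_right, tsum_fintype, ← Nat.cast_sum,
    ← Nat.card_sigma, ← Nat.card_congr (MulAction.selfEquivSigmaOrbits' (X ≃g X) W),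
    div_eq_mul_inv]

end LiftGroup

/-! ### Covolumes with large denominators -/

/-- In lowest terms, the denominator of `N / M` keeps a factor `p ^ α` if `M` is divisible by a
power of `p` that exceeds `p ^ α * N`. -/
lemma exists_coprime_div_eq {p α k N M : ℕ} (hp : p.Prime) (hN : 0 < N) (hM : 0 < M)
    (hdvd : p ^ k ∣ M) (hlt : p ^ α * N < p ^ k) :
    ∃ a b : ℕ, 0 < a ∧ 0 < b ∧ a.Coprime b ∧ (N : ℝ≥0∞) / M = (a : ℝ≥0∞) / b ∧ p ^ α ∣ b := by
  obtain ⟨a, b, hab, ha, hb⟩ := Nat.exists_coprime N M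
  set g := N.gcd M
  have hg : 0 < g := Nat.gcd_pos_of_pos_left _ hN
  have ha0 : 0 < a := Nat.pos_of_ne_zero fun h => by simp [h] at ha; omega
  have hb0 : 0 < b := Nat.pos_of_ne_zero fun h => by simp [h] at hb; omega
  refine ⟨a, b, ha0, hb0, hab, ?_, ?_⟩
  · rw [ha, hb]
    push_cast
    exact ENNReal.mul_div_mul_right _ _ (by exact_mod_cast hg.ne') (ENNReal.natCast_ne_top _)
  · have hgN : g ≤ N := Nat.le_of_dvd hN (Nat.gcd_dvd_left N M)
    have := Fact.mk hp
    rw [hb] at hdvd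
    rw [padicValNat_dvd_iff_le hb0.ne']
    rw [padicValNat_dvd_iff_le (Nat.mul_pos hb0 hg).ne', padicValNat.mul hb0.ne' hg.ne'] at hdvd
    have h1 : p ^ padicValNat p g ≤ N := (Nat.le_of_dvd hg pow_padicValNat_dvd).trans hgN
    have h2 : p ^ (α + padicValNat p g) < p ^ k := by
      rw [pow_add]
      exact (Nat.mul_le_mul_left _ h1).trans_lt hlt
    have h3 := (Nat.pow_lt_pow_iff_right hp.one_lt).1 h2
    omega

lemma exists_mul_lt_pow {p C : ℕ} (hp : 2 ≤ p) (hC : 0 < C) : ∃ m, 0 < m ∧ C * m < p ^ m := by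
  refine ⟨4 * C, by omega, ?_⟩
  have h1 : C + 1 ≤ p ^ C := Nat.lt_pow_self hp
  calc C * (4 * C) < (C + 1) ^ 4 := by nlinarith [sq_nonneg C, pow_pos hC 3, pow_pos hC 4]
    _ ≤ (p ^ C) ^ 4 := Nat.pow_le_pow_left h1 4
    _ = p ^ (4 * C) := by rw [← pow_mul, mul_comm]

/-- A biregular tree of degrees `n > p` and `2` covers each necklace with `p` and `n - p` parallel
strings. -/
lemma exists_covering_necklace {V : Type*} {T : SimpleGraph V} {n p m : ℕ}
    (hT : IsBiregularTree T n 2) (hp : 0 < p) (hpn : p ≤ n) :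
    ∃ π : V → NecklaceVertex m p (n - p), IsCovering T (necklace m p (n - p)) π := by
  obtain ⟨htree, c, hc⟩ := hT
  obtain ⟨r⟩ := htree.connected.nonempty
  obtain ⟨y, hy⟩ : ∃ y, c r = necklaceColoring (m := m) (p := p) (q := n - p) y := by
    cases c r
    · exact ⟨Sum.inr (0, Sum.inl ⟨0, hp⟩), rfl⟩
    · exact ⟨Sum.inl (0, true), rfl⟩
  obtain ⟨π, hπ, -⟩ := exists_covering htree c necklaceColoring (fun b => if b = true then n else 2)
    (fun v => by rw [hc v]; split_ifs <;> rfl) (fun w => by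
      rcases w with ⟨i, e⟩ | b
      · rw [encard_neighborSet_bead, Nat.add_sub_cancel' hpn]
        rfl
      · rw [encard_neighborSet_string]
        rfl) r y hy
  exact ⟨π, hπ⟩

end TreeLattice

theorem mainTheorem6 {V : Type*} (T : SimpleGraph V) (n : ℕ) (hn : 3 ≤ n)
    (hT : TreeLattice.IsBiregularTree T n 2) :
    ∃ μ : MeasureTheory.Measure (T ≃g T), TreeLattice.IsNormalizedHaar V μ ∧
      ∀ p : ℕ, p.Prime → p < n → ∀ α : ℕ,
        ∃ Γ : Subgroup (T ≃g T), TreeLattice.IsUniformLattice Γ ∧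
          ∃ a b : ℕ, 0 < a ∧ 0 < b ∧ a.Coprime b ∧
            MeasureTheory.covolume Γ (T ≃g T) μ = (a : ENNReal) / (b : ENNReal) ∧
            p ^ α ∣ b := by
  obtain ⟨htree, c, hc⟩ := id hT
  have hconn := htree.connected
  have hfin : ∀ v, (T.neighborSet v).Finite := fun v => by
    rw [← Set.encard_lt_top_iff, hc v]
    split_ifs <;> exact ENat.natCast_lt_top _
  have := hconn.nonempty
  have := TreeLattice.countable_of_locallyFinite hconn hfin
  have hopen := TreeLattice.isOpen_stabilizer_aut (T := T)
  have hcomp := TreeLattice.isCompact_stabilizer_aut hconn hfin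
  have : Finite (MulAction.orbitRel.Quotient (T ≃g T) V) := by
    refine Finite.of_injective (fun o => c o.out) fun o o' h => ?_
    obtain ⟨g, hg⟩ := TreeLattice.exists_aut_of_color_eq htree c
      (fun b => if b = true then n else 2) (fun v => by rw [hc v]; split_ifs <;> rfl) h.symm
    rw [← Quotient.out_eq o, ← Quotient.out_eq o']
    exact Quotient.sound ⟨g, hg⟩
  obtain ⟨μ, hμ⟩ := TreeLattice.exists_isNormalizedHaar (G := T ≃g T) hopen hcomp
  refine ⟨μ, hμ, fun p hp hpn α => ?_⟩
  obtain ⟨m, hm, hlt⟩ := TreeLattice.exists_mul_lt_pow (C := p ^ α * (n + 2)) hp.two_le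
    (Nat.mul_pos (pow_pos hp.pos α) (by omega))
  have : NeZero m := ⟨hm.ne'⟩
  obtain ⟨π, hπ⟩ := TreeLattice.exists_covering_necklace (m := m) hT hp.pos hpn.le
  have hX := TreeLattice.necklace_connected (m := m) hp.pos (Nat.sub_pos_of_lt hpn)
  set Γ := TreeLattice.liftGroup T _ π
  obtain ⟨v⟩ := hconn.nonempty
  obtain ⟨e⟩ := TreeLattice.nonempty_stabilizer_equiv htree hX hπ v
  obtain ⟨e', -⟩ := TreeLattice.exists_orbit_equiv htree hX hπ
  have : Finite (MulAction.stabilizer Γ v) := Finite.of_equiv _ e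
  have : Finite (MulAction.orbitRel.Quotient Γ V) := Finite.of_equiv _ e'.symm
  have hΓ : TreeLattice.IsUniformLattice Γ :=
    TreeLattice.isUniformLattice_of_finite hopen hcomp Γ v
  refine ⟨Γ, hΓ, ?_⟩
  rw [hμ.covolume_eq Γ hΓ.discrete,
    TreeLattice.tsum_inv_card_stabilizer_liftGroup htree hX hπ, TreeLattice.card_necklaceVertex]
  refine TreeLattice.exists_coprime_div_eq hp (Nat.mul_pos hm (by omega)) Nat.card_pos
    (TreeLattice.pow_dvd_card_aut_necklace hp.pos) ?_
  rw [Nat.add_sub_cancel' hpn.le]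
  calc p ^ α * (m * (n + 2)) = p ^ α * (n + 2) * m := by ring
    _ < p ^ m := hlt
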